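/- For $d \in \mathbb{N}$, let $G_d$ be the unit distance graph of $\mathbb{R}^d$: its vertex set is $\mathbb{R}^d$, and two points are adjacent if and only if their Euclidean distance is $1$. For $X \subseteq \mathbb{R}^d$ let $G_d[X]$ be the subgraph of $G_d$ induced by $X$. For a nonempty bounded set $X$ let $r(X)$ be the radius of the minimal enclosing ball of $X$, that is, the least radius of a closed ball containing $X$; for unbounded $X$ put $r(X)=\infty$. **Theorem.** Let $X \subseteq \mathbb{R}^d$ be nonempty, closed and convex. Then $G_d[X]$ is connected if and only if either $r(X)=0$, or $r(X)\ge 1$ and $X$ contains three affinely independent points. Moreover, if $X$ is bounded and $G_d[X]$ is connected, then the diameter of the graph $G_d[X]$ (the maximum, over all pairs of its vertices, of the least number of edges of a path between them) is finite. -/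

import Mathlib

open scoped ENNReal NNReal

/-- The unit distance graph of `ℝ^d`: two points are adjacent iff their Euclidean distance is `1`. -/
def unitDistGraph (d : ℕ) : SimpleGraph (EuclideanSpace ℝ (Fin d)) where
  Adj x y := dist x y = 1
  symm := ⟨fun x y h => by rw [dist_comm]; exact h⟩
  loopless := ⟨fun x h => by simp at h⟩

/-- The radius of the minimal enclosing ball of `X`: the least radius of a closed ball containing
`X` (it is attained when `X` is bounded, see `exists_subset_closedBall_mebRadius`), and `∞` when no
ball contains `X`, that is, when `X` is unbounded. -/
noncomputable def mebRadius {d : ℕ} (X : Set (EuclideanSpace ℝ (Fin d))) : ℝ≥0∞ :=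
  ⨅ (v : EuclideanSpace ℝ (Fin d)) (ρ : ℝ≥0) (_ : X ⊆ Metric.closedBall v ρ), (ρ : ℝ≥0∞)

/-- The radius bounds from below the radius of every enclosing ball. -/
theorem mebRadius_le {d : ℕ} {X : Set (EuclideanSpace ℝ (Fin d))}
    {v : EuclideanSpace ℝ (Fin d)} {ρ : ℝ≥0} (h : X ⊆ Metric.closedBall v ρ) :
    mebRadius X ≤ ρ :=
  iInf_le_of_le v (iInf_le_of_le ρ (iInf_le _ h))

/-- The radius is finite exactly for bounded sets. -/
theorem mebRadius_ne_top_iff {d : ℕ} {X : Set (EuclideanSpace ℝ (Fin d))} :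
    mebRadius X ≠ ⊤ ↔ Bornology.IsBounded X := by
  constructor
  · intro h
    by_contra hb
    apply h
    simp only [mebRadius, iInf_eq_top]
    intro v ρ hX
    exact absurd (Metric.isBounded_closedBall.subset hX) hb
  · intro h
    obtain ⟨r, hr⟩ := h.subset_closedBall (0 : EuclideanSpace ℝ (Fin d))
    have h2 : X ⊆ Metric.closedBall 0 (r.toNNReal : ℝ) :=
      hr.trans (Metric.closedBall_subset_closedBall (Real.le_coe_toNNReal r))
    exact ne_top_of_le_ne_top ENNReal.coe_ne_top (mebRadius_le h2)

/-- A bounded set has an enclosing ball of radius `mebRadius X`. -/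
theorem exists_subset_closedBall_mebRadius {d : ℕ} {X : Set (EuclideanSpace ℝ (Fin d))}
    (hX : Bornology.IsBounded X) :
    ∃ v, X ⊆ Metric.closedBall v (mebRadius X).toReal := by
  rcases X.eq_empty_or_nonempty with rfl | ⟨x₀, hx₀⟩
  · exact ⟨0, Set.empty_subset _⟩
  have hfin := mebRadius_ne_top_iff.2 hX
  set r : ℝ := (mebRadius X).toReal with hr
  let K : ℕ → Set (EuclideanSpace ℝ (Fin d)) :=
    fun n => {v | X ⊆ Metric.closedBall v (r + 1 / ((n : ℝ) + 1))}
  have hK : ∀ n, K n = ⋂ x ∈ X, Metric.closedBall x (r + 1 / ((n : ℝ) + 1)) := by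
    intro n
    ext v
    simp only [K, Set.mem_ofPred_eq, Set.mem_iInter, Set.subset_def, Metric.mem_closedBall]
    exact forall₂_congr fun x _ => by rw [dist_comm]
  have hcl : ∀ n, IsClosed (K n) := fun n => by
    rw [hK]; exact isClosed_biInter fun x _ => Metric.isClosed_closedBall
  have hne : (⋂ n, K n).Nonempty := by
    apply IsCompact.nonempty_iInter_of_sequence_nonempty_isCompact_isClosed K _ _ _ hcl
    · intro n v hv
      refine Set.Subset.trans hv (Metric.closedBall_subset_closedBall ?_)
      have := Nat.one_div_le_one_div (α := ℝ) (Nat.le_succ n)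
      simpa using this
    · intro n
      have hlt : mebRadius X < mebRadius X + ENNReal.ofReal (1 / ((n : ℝ) + 1)) :=
        ENNReal.lt_add_right hfin (by
          have : (0 : ℝ) < 1 / ((n : ℝ) + 1) := by positivity
          exact (ENNReal.ofReal_pos.2 this).ne')
      conv_lhs at hlt => rw [mebRadius]
      simp only [iInf_lt_iff] at hlt
      obtain ⟨v, ρ, hv, hρ⟩ := hlt
      refine ⟨v, hv.trans (Metric.closedBall_subset_closedBall ?_)⟩
      have h3 := ENNReal.toReal_mono (by finiteness) hρ.le
      rw [ENNReal.toReal_add hfin (by finiteness),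
        ENNReal.toReal_ofReal (by positivity)] at h3
      simpa [hr] using h3
    · exact (isCompact_closedBall x₀ _).of_isClosed_subset (hcl 0)
        (by rw [hK]; exact Set.biInter_subset_of_mem hx₀)
  obtain ⟨v, hv⟩ := hne
  refine ⟨v, fun x hx => ?_⟩
  rw [Metric.mem_closedBall]
  refine ge_of_tendsto' (x := Filter.atTop)
    (f := fun n : ℕ => r + 1 / ((n : ℝ) + 1)) ?_ fun n => Set.mem_iInter.1 hv n hx
  simpa using tendsto_one_div_add_atTop_nhds_zero_nat.const_add r

/-!
The unit distance graph of a closed convex set `X ⊆ ℝ^d`.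

**Sufficiency.** Assume `r(X) ≥ 1` and `dim X ≥ 2`; the first condition gives every `x ∈ X` a point
of `X` at distance at least `1`. Inside the affine span of `X` the set has interior points. The heart
of the proof is that the graph is locally connected: every `x ∈ X` has a neighbourhood in `X` all of
whose points are within graph distance `8` of `x`.

* If `x n` is an edge between interior points, the bar `x n` can be moved freely near its place
  while its endpoints stay in `X`: take `v ⟂ n - x` and `s` small; then `x` and `x + s v` have a
  common neighbour near `n`, off the line through them, and this persists for `x + s v` and every
  point close enough to `x` (`eventually_edist_le_four`).
* If `x` has a point of `X` farther than `1`, then, as `dim X ≥ 2`, it has several interior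
  neighbours. At most one point `c` of `X` has all of `X` within distance `1`
  (`Convex.eq_of_forall_dist_le_one`), so some interior neighbour `m ≠ c` of `x` is available, and
  `m` has an interior neighbour of its own. Points near `x` have neighbours near `m`, and these are
  close to `m` in the graph by the first step (`Convex.eventually_edist_le_six`). Moving the
  bar `x m` itself would not do: if `x` is a sharp tip of `X`, no path staying near the two ends of
  the bar leads from `x` to another point near `x`.
* The exceptional point `c` is adjacent to all points of `X` on its unit sphere, to which the
  previous step applies; by compactness, points near `c` have neighbours near that sphere
  (`Convex.eventually_edist_le_eight`).

A convex set is connected, so the graph is; if `X` is bounded it is compact, and finitely many of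
the neighbourhoods bound the diameter (`Convex.unitGraph_connected`).

**Necessity.** If `0 < r(X) < 1`, the centre of the minimal enclosing ball, moved to the nearest
point of `X`, is an isolated vertex (`one_le_mebRadius_of_connected`). If `X` lies on a line, the
positions of the points of one component differ by integers
(`Collinear.not_connected_unitGraph`).
-/

open Filter Topology Metric

/-! ### Unit distance graphs of subsets of metric spaces -/

/-- The unit distance graph on a subset `X` of a metric space: two points of `X` are adjacent iff
their distance is `1`. -/
def unitGraph {P : Type*} [PseudoMetricSpace P] (X : Set P) : SimpleGraph X where
  Adj x y := dist (x : P) y = 1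
  symm := ⟨fun x y h => by rw [dist_comm]; exact h⟩
  loopless := ⟨fun x h => by simp at h⟩

theorem unitGraph_edist_le_one {P : Type*} [PseudoMetricSpace P] {X : Set P} {x y : X}
    (h : dist (x : P) y = 1) : (unitGraph X).edist x y ≤ 1 :=
  (SimpleGraph.edist_eq_one_iff_adj.2 h).le

theorem SimpleGraph.edist_le_add {V : Type*} {G : SimpleGraph V} {u v w : V} {a b : ℕ∞}
    (h₁ : G.edist u v ≤ a) (h₂ : G.edist v w ≤ b) : G.edist u w ≤ a + b :=
  G.edist_triangle.trans (add_le_add h₁ h₂)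

variable {E : Type*} [NormedAddCommGroup E] [InnerProductSpace ℝ E]

/-! ### Common neighbours and local connectivity around an edge -/

/-- The apex of the isosceles triangle with base from `0` to `d` and legs of length `1`, on the side
of the unit vector `e` orthogonal to `d`, has norm `1`. -/
theorem norm_half_add_sqrt_smul {d e : E} (hd : ‖d‖ ≤ 2) (he : ‖e‖ = 1) (hde : inner ℝ d e = 0) :
    ‖(1 / 2 : ℝ) • d + √(1 - ‖d‖ ^ 2 / 4) • e‖ = 1 := by
  have h0 : (0 : ℝ) ≤ 1 - ‖d‖ ^ 2 / 4 := by nlinarith [norm_nonneg d]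
  have : ‖(1 / 2 : ℝ) • d + √(1 - ‖d‖ ^ 2 / 4) • e‖ ^ 2 = 1 := by
    rw [norm_add_sq_real, norm_smul, norm_smul, inner_smul_left, inner_smul_right, hde, he,
      mul_one, Real.norm_of_nonneg (Real.sqrt_nonneg _), Real.sq_sqrt h0]
    simp
    ring
  nlinarith [norm_nonneg ((1 / 2 : ℝ) • d + √(1 - ‖d‖ ^ 2 / 4) • e)]

/-- If `a ≠ b` have a common unit neighbour `a + (b - a) / 2 + t e` off the line `ab`, then every
point near `b` has a common unit neighbour with `a` close to that one. -/
theorem eventually_exists_common_neighbour {a d e : E} (hd : d ≠ 0) (hd2 : ‖d‖ < 2)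
    (he : ‖e‖ = 1) (hde : inner ℝ d e = 0) {U : Set E}
    (hU : U ∈ 𝓝 (a + ((1 / 2 : ℝ) • d + √(1 - ‖d‖ ^ 2 / 4) • e))) :
    ∀ᶠ b in 𝓝 (a + d), ∃ n ∈ U, dist a n = 1 ∧ dist b n = 1 := by
  -- `q b` is the component of `e` orthogonal to `b - a`
  let q : E → E := fun b => e - (inner ℝ (b - a) e / ‖b - a‖ ^ 2) • (b - a)
  let n : E → E := fun b => a + ((1 / 2 : ℝ) • (b - a) +
    √(1 - ‖b - a‖ ^ 2 / 4) • (‖q b‖⁻¹ • q b))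
  have hq : q (a + d) = e := by simp [q, hde]
  have hqc : ContinuousAt q (a + d) := by
    have : ‖a + d - a‖ ^ 2 ≠ 0 := by simpa using hd
    fun_prop (disch := assumption)
  have hnc : ContinuousAt n (a + d) := by
    have : ‖q (a + d)‖ ≠ 0 := by rw [hq, he]; norm_num
    fun_prop (disch := assumption)
  have hn : n (a + d) = a + ((1 / 2 : ℝ) • d + √(1 - ‖d‖ ^ 2 / 4) • e) := by
    simp [n, hq, he]
  have hc : Continuous fun b : E => ‖b - a‖ := by fun_prop
  have h1 : ∀ᶠ b in 𝓝 (a + d), ‖b - a‖ < 2 :=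
    hc.continuousAt.eventually_lt continuousAt_const (by simpa using hd2)
  have h2 : ∀ᶠ b in 𝓝 (a + d), ‖b - a‖ ≠ 0 :=
    hc.continuousAt.eventually_ne (by simpa using hd)
  have h3 : ∀ᶠ b in 𝓝 (a + d), q b ≠ 0 :=
    hqc.eventually_ne (by rw [hq]; rintro rfl; simp at he)
  have h4 : ∀ᶠ b in 𝓝 (a + d), n b ∈ U := hnc (by rw [hn]; exact hU)
  filter_upwards [h1, h2, h3, h4] with b h1 h2 h3 h4
  have hunit : ‖‖q b‖⁻¹ • q b‖ = 1 := by
    rw [norm_smul, norm_inv, norm_norm, inv_mul_cancel₀ (norm_ne_zero_iff.2 h3)]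
  have horth : inner ℝ (b - a) (‖q b‖⁻¹ • q b) = 0 := by
    rw [inner_smul_right]
    simp only [q]
    rw [inner_sub_right, inner_smul_right, real_inner_self_eq_norm_sq,
      div_mul_cancel₀ _ (pow_ne_zero 2 h2), sub_self, mul_zero]
  refine ⟨n b, h4, ?_, ?_⟩
  · rw [dist_comm, dist_eq_norm]
    simp only [n, add_sub_cancel_left]
    exact norm_half_add_sqrt_smul h1.le hunit horth
  · have := norm_half_add_sqrt_smul (d := -(b - a)) (by rw [norm_neg]; exact h1.le) hunit
      (by rw [inner_neg_left, horth, neg_zero])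
    rw [dist_comm, dist_eq_norm, ← this, norm_neg]
    congr 1
    simp only [n]
    module

/-- Around an edge whose endpoints are interior to `X`, the graph is locally connected: with
`v ⟂ n - x` and `s` small, `x` and `x + s v` have a common neighbour near `n`, and so have
`x + s v` and any point close enough to `x`. The hypothesis `hE` says that `E` has dimension at
least `2`. -/
theorem eventually_edist_le_four {X : Set E} (hE : ∀ u : E, ∃ v : E, v ≠ 0 ∧ inner ℝ u v = 0)
    {x n : E} (hx : x ∈ interior X) (hn : n ∈ interior X) (hxn : dist x n = 1) :
    ∀ᶠ y in 𝓝 x, ∀ hy : y ∈ X,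
      (unitGraph X).edist ⟨x, interior_subset hx⟩ ⟨y, hy⟩ ≤ 4 := by
  obtain ⟨v, hv0, hv⟩ := hE (n - x)
  have he : ‖n - x‖ = 1 := by rw [← dist_eq_norm, dist_comm, hxn]
  -- the apex of the isosceles triangle with base `x`, `x + s v` and unit legs tends to `n`
  have hc1 : Tendsto (fun s : ℝ => x + s • v) (𝓝[≠] 0) (𝓝 x) := by
    have : Continuous (fun s : ℝ => x + s • v) := by fun_prop
    simpa using (this.tendsto 0).mono_left nhdsWithin_le_nhds
  have hc2 : Tendsto (fun s : ℝ => x + ((1 / 2 : ℝ) • (s • v) +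
      √(1 - ‖s • v‖ ^ 2 / 4) • (n - x))) (𝓝[≠] 0) (𝓝 n) := by
    have : Continuous (fun s : ℝ => x + ((1 / 2 : ℝ) • (s • v) +
      √(1 - ‖s • v‖ ^ 2 / 4) • (n - x))) := by fun_prop
    simpa using (this.tendsto 0).mono_left nhdsWithin_le_nhds
  have hc3 : Tendsto (fun s : ℝ => ‖s • v‖) (𝓝[≠] 0) (𝓝 0) := by
    have : Continuous (fun s : ℝ => ‖s • v‖) := by fun_prop
    simpa using (this.tendsto 0).mono_left nhdsWithin_le_nhds
  obtain ⟨s, hs1, hs2, hs3, hs0⟩ := ((hc1.eventually (isOpen_interior.mem_nhds hx)).and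
    ((hc2.eventually (isOpen_interior.mem_nhds hn)).and
    ((hc3.eventually (gt_mem_nhds (show (0 : ℝ) < 2 by norm_num))).and
      self_mem_nhdsWithin))).exists
  have hd0 : s • v ≠ 0 := smul_ne_zero hs0 hv0
  have hperp : inner ℝ (s • v) (n - x) = 0 := by
    rw [inner_smul_left, real_inner_comm, hv, mul_zero]
  have hapex : x + s • v + ((1 / 2 : ℝ) • (-(s • v)) +
      √(1 - ‖-(s • v)‖ ^ 2 / 4) • (n - x)) = x + ((1 / 2 : ℝ) • (s • v) +
      √(1 - ‖s • v‖ ^ 2 / 4) • (n - x)) := by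
    rw [norm_neg]; module
  have key := eventually_exists_common_neighbour (a := x + s • v) (d := -(s • v)) (e := n - x)
    (U := interior X) (neg_ne_zero.2 hd0) (by rwa [norm_neg]) he
    (by rw [inner_neg_left, hperp, neg_zero])
    (by rw [hapex]; exact isOpen_interior.mem_nhds hs2)
  rw [add_neg_cancel_right] at key
  have step : ∀ y (hy : y ∈ X), (∃ n ∈ interior X, dist (x + s • v) n = 1 ∧ dist y n = 1) →
      (unitGraph X).edist ⟨x + s • v, interior_subset hs1⟩ ⟨y, hy⟩ ≤ 1 + 1 := by
    rintro y hy ⟨m, hm, h1, h2⟩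
    exact SimpleGraph.edist_le_add (v := ⟨m, interior_subset hm⟩) (unitGraph_edist_le_one h1)
      (unitGraph_edist_le_one (by rw [dist_comm]; exact h2))
  filter_upwards [key] with y h hy
  have h1 := step x (interior_subset hx) key.self_of_nhds
  rw [SimpleGraph.edist_comm] at h1
  exact (SimpleGraph.edist_le_add h1 (step y hy h)).trans_eq (by norm_num)

/-! ### Local connectivity of the graph of a convex set -/

/-- The point of the ray from `x` through `y` at distance `1` from `x` is interior to the convex
set `X` when `x ∈ X` and `y` is an interior point at distance more than `1`. -/
theorem Convex.add_normalized_mem_interior {X : Set E} (hX : Convex ℝ X) {x y : E} (hx : x ∈ X)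
    (hy : y ∈ interior X) (hxy : 1 < dist x y) : x + ‖y - x‖⁻¹ • (y - x) ∈ interior X := by
  rw [dist_comm, dist_eq_norm] at hxy
  have h0 : 0 < ‖y - x‖ := by linarith
  exact hX.add_smul_sub_mem_interior hx hy ⟨inv_pos.2 h0, inv_le_one_of_one_le₀ hxy.le⟩

theorem dist_add_normalized {x y : E} (h : y ≠ x) : dist x (x + ‖y - x‖⁻¹ • (y - x)) = 1 := by
  rw [dist_self_add_right, norm_smul, norm_inv, norm_norm,
    inv_mul_cancel₀ (norm_ne_zero_iff.2 (sub_ne_zero.2 h))]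

theorem Convex.exists_interior_dist_eq_one {X : Set E} (hX : Convex ℝ X)
    (hE : ∀ u : E, ∃ v : E, v ≠ 0 ∧ inner ℝ u v = 0)
    (hint : (interior X).Nonempty) {x : E} (hx : x ∈ X) (hfar : ∃ y ∈ X, 1 < dist x y) (c : E) :
    ∃ m ∈ interior X, dist x m = 1 ∧ m ≠ c := by
  obtain ⟨y₀, hy₀, hd₀⟩ := hfar
  have hopen : IsOpen {y | 1 < dist x y} := isOpen_lt (by fun_prop) (by fun_prop)
  have hcl : y₀ ∈ closure (interior X) := by
    rw [hX.closure_interior_eq_closure_of_nonempty_interior hint]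
    exact subset_closure hy₀
  obtain ⟨y, hdy, hy⟩ := mem_closure_iff.1 hcl _ hopen hd₀
  have hne : ∀ {z}, 1 < dist x z → z ≠ x := by
    rintro z hz rfl
    rw [dist_self] at hz
    linarith
  by_cases hm : x + ‖y - x‖⁻¹ • (y - x) = c
  swap
  · exact ⟨_, hX.add_normalized_mem_interior hx hy hdy, dist_add_normalized (hne hdy), hm⟩
  -- replace `y` by a nearby point off the line `xy`
  obtain ⟨v, hv0, hv⟩ := hE (y - x)
  have hc1 : Tendsto (fun s : ℝ => y + s • v) (𝓝[≠] 0) (𝓝 y) := by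
    have : Continuous (fun s : ℝ => y + s • v) := by fun_prop
    simpa using (this.tendsto 0).mono_left nhdsWithin_le_nhds
  obtain ⟨s, ⟨hs1, hs2⟩, hs0⟩ := ((hc1.eventually
    ((isOpen_interior.inter hopen).mem_nhds ⟨hy, hdy⟩)).and self_mem_nhdsWithin).exists
  refine ⟨_, hX.add_normalized_mem_interior hx hs1 hs2, dist_add_normalized (hne hs2), ?_⟩
  intro h
  have h1 := congrArg (fun z => inner ℝ (z - x) v) (h.trans hm.symm)
  simp only [add_sub_cancel_left, inner_smul_left, hv, mul_zero] at h1
  rw [add_sub_right_comm, inner_add_left, hv, inner_smul_left, real_inner_self_eq_norm_sq] at h1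
  have hne' := sub_ne_zero.2 (hne hs2)
  rw [add_sub_right_comm] at hne'
  simp [hv0, hne'] at h1
  exact hs0 h1

/-- If no open unit ball centred at a point of the convex set `X` contains `X`, then at most one
closed unit ball centred at a point of `X` does: the midpoint of two such centres would be at
distance less than `1` from every point of `X`. -/
theorem Convex.eq_of_forall_dist_le_one {X : Set E} (hX : Convex ℝ X)
    (hfar : ∀ x ∈ X, ∃ y ∈ X, 1 ≤ dist x y) {a b : E} (ha : a ∈ X) (hb : b ∈ X)
    (ha1 : ∀ y ∈ X, dist a y ≤ 1) (hb1 : ∀ y ∈ X, dist b y ≤ 1) : a = b := by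
  by_contra hab
  obtain ⟨y, hy, h1⟩ := hfar _ (hX.midpoint_mem ha hb)
  have h := parallelogram_law_with_norm ℝ (a - y) (b - y)
  have h2 : ‖a - y + (b - y)‖ = 2 * dist (midpoint ℝ a b) y := by
    have h0 : a - y + (b - y) = (2 : ℝ) • (midpoint ℝ a b - y) := by
      rw [midpoint_eq_smul_add, smul_sub, smul_smul, mul_invOf_self, one_smul, two_smul]
      abel
    rw [h0, norm_smul, Real.norm_ofNat, dist_eq_norm]
  have h3 : 0 < ‖a - b‖ := norm_pos_iff.2 (sub_ne_zero.2 hab)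
  have h4 := ha1 y hy
  have h5 := hb1 y hy
  rw [sub_sub_sub_cancel_right, h2, ← dist_eq_norm, ← dist_eq_norm, ← dist_eq_norm] at h
  rw [← dist_eq_norm] at h3
  nlinarith [dist_nonneg (x := a) (y := y), dist_nonneg (x := b) (y := y)]

/-- A point `x` with a point of `X` farther than `1` has an interior neighbour `m` which itself has
an interior neighbour; points near `x` have neighbours near `m`, and these are close to `m` in the
graph. -/
theorem Convex.eventually_edist_le_six {X : Set E} (hX : Convex ℝ X)
    (hE : ∀ u : E, ∃ v : E, v ≠ 0 ∧ inner ℝ u v = 0) (hint : (interior X).Nonempty)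
    (hfar : ∀ x ∈ X, ∃ y ∈ X, 1 ≤ dist x y) (x : X) (hx : ∃ y ∈ X, 1 < dist (x : E) y) :
    ∀ᶠ y in 𝓝 (x : E), ∀ hy : y ∈ X, (unitGraph X).edist x ⟨y, hy⟩ ≤ 6 := by
  obtain ⟨m, hm, hxm, hmfar⟩ : ∃ m ∈ interior X, dist (x : E) m = 1 ∧ ∃ z ∈ X, 1 < dist m z := by
    by_cases hc : ∃ c ∈ X, ∀ z ∈ X, dist c z ≤ 1
    · obtain ⟨c, hcX, hc⟩ := hc
      obtain ⟨m, hm, hxm, hmc⟩ := hX.exists_interior_dist_eq_one hE hint x.2 hx c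
      refine ⟨m, hm, hxm, ?_⟩
      by_contra! h
      exact hmc (hX.eq_of_forall_dist_le_one hfar (interior_subset hm) hcX h hc)
    · push Not at hc
      obtain ⟨m, hm, hxm, -⟩ := hX.exists_interior_dist_eq_one hE hint x.2 hx 0
      exact ⟨m, hm, hxm, hc m (interior_subset hm)⟩
  obtain ⟨n, hn, hmn, -⟩ :=
    hX.exists_interior_dist_eq_one hE hint (interior_subset hm) hmfar 0
  have hloc := (eventually_edist_le_four hE hm hn hmn).and (isOpen_interior.eventually_mem hm)
  have hne : m ≠ x := by rintro rfl; simp at hxm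
  have hcont : ContinuousAt (fun y : E => y + ‖m - y‖⁻¹ • (m - y)) x := by
    have : ‖m - (x : E)‖ ≠ 0 := norm_ne_zero_iff.2 (sub_ne_zero.2 hne)
    fun_prop (disch := assumption)
  have hval : (x : E) + ‖m - (x : E)‖⁻¹ • (m - (x : E)) = m := by
    rw [← dist_eq_norm, dist_comm, hxm]; simp
  have htend : Tendsto (fun y : E => y + ‖m - y‖⁻¹ • (m - y)) (𝓝 x) (𝓝 m) := by
    simpa only [hval] using hcont.tendsto
  have h1 := htend.eventually hloc
  filter_upwards [h1, (continuousAt_id.eventually_ne hne.symm : ∀ᶠ y in 𝓝 (x : E), id y ≠ m)]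
    with y ⟨h1, h2⟩ hym hy
  have e1 := unitGraph_edist_le_one (x := x) (y := ⟨m, interior_subset hm⟩) hxm
  have e2 := unitGraph_edist_le_one (x := ⟨_, interior_subset h2⟩) (y := ⟨y, hy⟩)
    (by rw [dist_comm]; exact dist_add_normalized (Ne.symm hym))
  exact (SimpleGraph.edist_le_add (SimpleGraph.edist_le_add e1 (h1 (interior_subset h2)))
    e2).trans_eq (by norm_num)

theorem Convex.exists_dist_eq_one {X : Set E} (hX : Convex ℝ X) {x : E} (hx : x ∈ X)
    (hfar : ∃ y ∈ X, 1 ≤ dist x y) : ∃ y ∈ X, dist x y = 1 := by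
  obtain ⟨y, hy, h⟩ := hfar
  rw [dist_comm, dist_eq_norm] at h
  refine ⟨x + ‖y - x‖⁻¹ • (y - x), hX.add_smul_sub_mem hx hy
    ⟨by positivity, inv_le_one_of_one_le₀ h⟩, dist_add_normalized ?_⟩
  rintro rfl
  simp at h
  linarith

/-- If all of the compact set `X` lies within distance `1` of `c`, points near `c` have neighbours
near points of the unit sphere around `c`, which have farther points in `X`. -/
theorem Convex.eventually_edist_le_eight {X : Set E} (hX : Convex ℝ X) (hXc : IsCompact X)
    (hE : ∀ u : E, ∃ v : E, v ≠ 0 ∧ inner ℝ u v = 0) (hint : (interior X).Nonempty)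
    (hfar : ∀ x ∈ X, ∃ y ∈ X, 1 ≤ dist x y) (c : X) (hc : ∀ y ∈ X, dist (c : E) y ≤ 1) :
    ∀ᶠ y in 𝓝 (c : E), ∀ hy : y ∈ X, (unitGraph X).edist c ⟨y, hy⟩ ≤ 8 := by
  have key : ∀ᶠ y in 𝓝 (c : E), ∀ z ∈ X, z ∈ X → dist y z = 1 → ∀ hy : y ∈ X,
      (unitGraph X).edist c ⟨y, hy⟩ ≤ 8 := by
    refine hXc.induction_on (p := fun S => ∀ᶠ y in 𝓝 (c : E), ∀ z ∈ S, z ∈ X → dist y z = 1 →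
      ∀ hy : y ∈ X, (unitGraph X).edist c ⟨y, hy⟩ ≤ 8) ?_ ?_ ?_ ?_
    · simp
    · intro s t hst ht
      filter_upwards [ht] with y h z hz using h z (hst hz)
    · intro s t hs ht
      filter_upwards [hs, ht] with y h1 h2 z hz
      exact hz.elim (h1 z) (h2 z)
    · intro z hz
      by_cases hcz : dist (c : E) z = 1
      · have hzfar : ∃ w ∈ X, 1 < dist z w := by
          by_contra! h
          rw [hX.eq_of_forall_dist_le_one hfar hz c.2 h hc, dist_self] at hcz
          exact zero_ne_one hcz
        refine ⟨_, mem_nhdsWithin_of_mem_nhds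
          (hX.eventually_edist_le_six hE hint hfar ⟨z, hz⟩ hzfar), Eventually.of_forall ?_⟩
        intro y w hw hwX hyw hy
        have e1 := unitGraph_edist_le_one (x := c) (y := ⟨z, hz⟩) hcz
        have e2 := unitGraph_edist_le_one (x := ⟨w, hwX⟩) (y := ⟨y, hy⟩)
          (by rw [dist_comm]; exact hyw)
        exact (SimpleGraph.edist_le_add (SimpleGraph.edist_le_add e1 (hw hwX)) e2).trans_eq
          (by norm_num)
      · have hcont : Continuous fun p : E × E => dist p.1 p.2 := continuous_dist
        have hev : ∀ᶠ p in 𝓝 (c : E) ×ˢ 𝓝 z, dist p.1 p.2 ≠ 1 := by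
          rw [← nhds_prod_eq]
          exact (hcont.continuousAt (x := ((c : E), z))).eventually_ne hcz
        obtain ⟨pa, ha, pb, hb, hab⟩ := eventually_prod_iff.1 hev
        refine ⟨{w | pb w}, mem_nhdsWithin_of_mem_nhds hb, ?_⟩
        filter_upwards [ha] with y hy w hw _ h1
        exact absurd h1 (hab hy hw)
  filter_upwards [key] with y h hy
  obtain ⟨z, hz, hyz⟩ := hX.exists_dist_eq_one hy (hfar y hy)
  exact h z hz hz hyz hy

theorem Convex.eventually_unitGraph_edist_le [ProperSpace E] {X : Set E} (hX : Convex ℝ X)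
    (hXc : IsClosed X)
    (hE : ∀ u : E, ∃ v : E, v ≠ 0 ∧ inner ℝ u v = 0) (hint : (interior X).Nonempty)
    (hfar : ∀ x ∈ X, ∃ y ∈ X, 1 ≤ dist x y) (x : X) :
    ∀ᶠ y in 𝓝 x, (unitGraph X).edist x y ≤ 8 := by
  have : ∀ᶠ y in 𝓝 (x : E), ∀ hy : y ∈ X, (unitGraph X).edist x ⟨y, hy⟩ ≤ 8 := by
    by_cases h : ∃ y ∈ X, 1 < dist (x : E) y
    · filter_upwards [hX.eventually_edist_le_six hE hint hfar x h] with y h1 hy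
      exact (h1 hy).trans (by norm_num)
    · push Not at h
      refine hX.eventually_edist_le_eight ?_ hE hint hfar x h
      refine (isCompact_closedBall (x : E) 1).of_isClosed_subset hXc fun y hy => ?_
      rw [mem_closedBall, dist_comm]
      exact h y hy
  filter_upwards [continuous_subtype_val.continuousAt.eventually this] with y h using h y.2

/-! ### From local to global connectivity -/

theorem SimpleGraph.preconnected_of_eventually_edist_le {V : Type*} [TopologicalSpace V]
    [PreconnectedSpace V] {G : SimpleGraph V} {N : ℕ}
    (h : ∀ x, ∀ᶠ y in 𝓝 x, G.edist x y ≤ N) : G.Preconnected := fun x y =>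
  have : Std.Symm G.Reachable := ⟨fun _ _ => Reachable.symm⟩
  PreconnectedSpace.induction₂ G.Reachable
    (fun x => (h x).mono fun _ hy =>
      G.reachable_of_edist_ne_top (ne_top_of_le_ne_top (ENat.natCast_ne_top N) hy))
    ⟨fun _ _ _ => Reachable.trans⟩ x y

theorem SimpleGraph.Preconnected.ediam_ne_top_of_eventually_edist_le {V : Type*}
    [TopologicalSpace V] [CompactSpace V] [Nonempty V] {G : SimpleGraph V} {N : ℕ}
    (hG : G.Preconnected) (h : ∀ x, ∀ᶠ y in 𝓝 x, G.edist x y ≤ N) : G.ediam ≠ ⊤ := by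
  obtain ⟨x₀⟩ := ‹Nonempty V›
  obtain ⟨M, hM⟩ : ∃ M : ℕ, ∀ y ∈ Set.univ, G.edist x₀ y ≤ M := by
    refine isCompact_univ.induction_on (p := fun S => ∃ M : ℕ, ∀ y ∈ S, G.edist x₀ y ≤ M)
      ⟨0, by simp⟩ ?_ ?_ ?_
    · rintro s t hst ⟨M, hM⟩
      exact ⟨M, fun y hy => hM y (hst hy)⟩
    · rintro s t ⟨M, hM⟩ ⟨K, hK⟩
      refine ⟨max M K, fun y hy => hy.elim (fun h => (hM y h).trans ?_) fun h => (hK y h).trans ?_⟩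
      · exact_mod_cast le_max_left M K
      · exact_mod_cast le_max_right M K
    · intro x _
      obtain ⟨K, hK⟩ := ENat.ne_top_iff_exists.1 (edist_ne_top_iff_reachable.2 (hG x₀ x))
      refine ⟨_, mem_nhdsWithin_of_mem_nhds (h x), K + N, fun y hy => ?_⟩
      exact (edist_le_add hK.ge hy).trans_eq (by push_cast; rfl)
  refine ne_top_of_le_ne_top (b := ((M + M : ℕ) : ℕ∞)) (ENat.natCast_ne_top _)
    (ediam_le_of_edist_le fun u v => ?_)
  have hu := hM u trivial
  rw [edist_comm] at hu
  exact (edist_le_add hu (hM v trivial)).trans_eq (by push_cast; rfl)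

/-! ### Transport along isometries -/

theorem SimpleGraph.Hom.edist_le {V V' : Type*} {G : SimpleGraph V} {G' : SimpleGraph V'}
    (f : G →g G') (u v : V) : G'.edist (f u) (f v) ≤ G.edist u v :=
  le_iInf fun w => (SimpleGraph.edist_le (w.map f)).trans_eq (by rw [Walk.length_map])

theorem SimpleGraph.Iso.ediam_le {V V' : Type*} {G : SimpleGraph V} {G' : SimpleGraph V'}
    (f : G ≃g G') : G'.ediam ≤ G.ediam :=
  ediam_le_of_edist_le fun u v => by
    simpa using (Hom.edist_le f.toHom (f.symm u) (f.symm v)).trans edist_le_ediam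

/-- An isometry onto a superset of `X` identifies the unit distance graphs of `X` and of its
preimage. -/
noncomputable def Isometry.unitGraphIso {P P' : Type*} [MetricSpace P] [MetricSpace P']
    {f : P' → P} (hf : Isometry f) {X : Set P} (hX : X ⊆ Set.range f) :
    unitGraph (f ⁻¹' X) ≃g unitGraph X where
  toEquiv := Equiv.ofBijective (fun w => ⟨f w, w.2⟩) <| by
    refine ⟨fun a b h => Subtype.ext (hf.injective (congrArg Subtype.val h)), fun x => ?_⟩
    obtain ⟨w, hw⟩ := hX x.2
    exact ⟨⟨w, by rw [Set.mem_preimage, hw]; exact x.2⟩, Subtype.ext hw⟩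
  map_rel_iff' := fun {a b} => by
    change dist (f a) (f b) = 1 ↔ dist (a : P') b = 1
    rw [hf.dist_eq]

/-! ### Sets of dimension at least two -/

theorem exists_ne_zero_inner_eq_zero [FiniteDimensional ℝ E] (h : 2 ≤ Module.finrank ℝ E) (u : E) :
    ∃ v : E, v ≠ 0 ∧ inner ℝ u v = 0 := by
  have hne : (ℝ ∙ u)ᗮ ≠ ⊥ := by
    rw [Ne, Submodule.orthogonal_eq_bot_iff]
    intro htop
    have := finrank_span_le_card (R := ℝ) ({u} : Set E)
    rw [htop, finrank_top, Set.toFinset_singleton, Finset.card_singleton] at this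
    omega
  obtain ⟨v, hv, hv0⟩ := Submodule.exists_mem_ne_zero_of_ne_bot hne
  exact ⟨v, hv0, Submodule.mem_orthogonal_singleton_iff_inner_right.1 hv⟩

/-- If every point of a closed convex set `X` of dimension at least `2` has a point of `X` at
distance at least `1`, the unit distance graph of `X` is connected, and it has finite diameter when
`X` is bounded. -/
theorem Convex.unitGraph_connected [FiniteDimensional ℝ E] {X : Set E} (hX : Convex ℝ X)
    (hXc : IsClosed X) (hne : X.Nonempty) (hrank : 2 ≤ Module.finrank ℝ (vectorSpan ℝ X))
    (hfar : ∀ x ∈ X, ∃ y ∈ X, 1 ≤ dist x y) :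
    (unitGraph X).Connected ∧ (Bornology.IsBounded X → (unitGraph X).ediam ≠ ⊤) := by
  obtain ⟨x₀, hx₀⟩ := hne
  let p : affineSpan ℝ X := ⟨x₀, subset_affineSpan ℝ X hx₀⟩
  have : Nonempty (affineSpan ℝ X) := ⟨p⟩
  -- pass to the affine span of `X`, identified with its direction, where `X` has interior points
  let e : (affineSpan ℝ X).direction ≃ᵢ affineSpan ℝ X := IsometryEquiv.vaddConst p
  let f : (affineSpan ℝ X).direction → E := fun w => (e w : E)
  have hf : Isometry f := isometry_subtype_coe.comp e.isometry
  have hrange : X ⊆ Set.range f := fun x hx =>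
    ⟨e.symm ⟨x, subset_affineSpan ℝ X hx⟩, by simp [f]⟩
  have hdir : ∀ u : (affineSpan ℝ X).direction, ∃ v, v ≠ 0 ∧ inner ℝ u v = 0 :=
    exists_ne_zero_inner_eq_zero (by rwa [direction_affineSpan])
  have hYconv : Convex ℝ (f ⁻¹' X) :=
    (hX.translate_preimage_left x₀).linear_preimage (affineSpan ℝ X).direction.subtype
  have hYc : IsClosed (f ⁻¹' X) := hXc.preimage hf.continuous
  have hYint : (interior (f ⁻¹' X)).Nonempty := by
    obtain ⟨_, y, hy, rfl⟩ := Set.Nonempty.intrinsicInterior hX ⟨x₀, hx₀⟩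
    refine ⟨e.symm y, ?_⟩
    have : f ⁻¹' X = e.toHomeomorph ⁻¹' ((↑) ⁻¹' X) := rfl
    rw [this, ← e.toHomeomorph.preimage_interior, Set.mem_preimage]
    simpa using hy
  have hYfar : ∀ x ∈ f ⁻¹' X, ∃ y ∈ f ⁻¹' X, 1 ≤ dist x y := by
    intro x hx
    obtain ⟨y, hy, hxy⟩ := hfar _ hx
    obtain ⟨w, rfl⟩ := hrange hy
    exact ⟨w, hy, by rwa [hf.dist_eq] at hxy⟩
  have hloc := hYconv.eventually_unitGraph_edist_le hYc hdir hYint hYfar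
  have hYne : Nonempty (f ⁻¹' X) := (hYint.mono interior_subset).to_subtype
  have : PreconnectedSpace (f ⁻¹' X) := Subtype.preconnectedSpace hYconv.isPreconnected
  have hpre : (unitGraph (f ⁻¹' X)).Preconnected :=
    SimpleGraph.preconnected_of_eventually_edist_le (N := 8) hloc
  have φ := hf.unitGraphIso hrange
  refine ⟨φ.connected_iff.1 ⟨hpre⟩, fun hb => ?_⟩
  have : CompactSpace (f ⁻¹' X) := isCompact_iff_compactSpace.1
    (isCompact_of_isClosed_isBounded hYc (hf.antilipschitz.isBounded_preimage hb))
  exact ne_top_of_le_ne_top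
    (hpre.ediam_ne_top_of_eventually_edist_le (N := 8) hloc) φ.ediam_le

/-! ### Necessity of the conditions -/

/-- The point of a complete convex set `X` nearest to `v` is at most as far as `v` from every point
of `X`. -/
theorem Convex.exists_mem_forall_dist_le {X : Set E} (hX : Convex ℝ X) (hXc : IsComplete X)
    (hne : X.Nonempty) (v : E) : ∃ p ∈ X, ∀ x ∈ X, dist x p ≤ dist x v := by
  obtain ⟨p, hp, hmin⟩ := exists_norm_eq_iInf_of_complete_convex hne hXc hX v
  refine ⟨p, hp, fun x hx => ?_⟩
  have h := (norm_eq_iInf_iff_real_inner_le_zero hX hp).1 hmin x hx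
  have h1 : ‖x - v‖ ^ 2 = ‖x - p‖ ^ 2 - 2 * inner ℝ (v - p) (x - p) + ‖v - p‖ ^ 2 := by
    rw [← sub_sub_sub_cancel_right x v p, norm_sub_sq_real, real_inner_comm]
  rw [dist_eq_norm, dist_eq_norm]
  refine abs_le_of_sq_le_sq' ?_ (norm_nonneg _) |>.2
  nlinarith [sq_nonneg ‖v - p‖]

/-- The unit distance graph of a convex subset of a line with two points is disconnected: positions
along the line of points in one component differ by integers. -/
theorem Collinear.not_connected_unitGraph {X : Set E} (hcol : Collinear ℝ X) (hX : Convex ℝ X)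
    (hnt : X.Nontrivial) : ¬ (unitGraph X).Connected := by
  intro hconn
  obtain ⟨a, ha, b, hb, hab⟩ := hnt
  obtain ⟨v, hv⟩ := (collinear_iff_of_mem ha).1 hcol
  have hv0 : v ≠ 0 := by
    rintro rfl
    obtain ⟨r, hr⟩ := hv b hb
    simp at hr
    exact hab hr.symm
  have hvn : 0 < ‖v‖ := norm_pos_iff.2 hv0
  have key : ∀ {x y : X}, (unitGraph X).Walk x y →
      ∃ k : ℤ, inner ℝ ((y : E) - x) v = k * ‖v‖ := by
    intro x y w
    induction w with
    | nil => exact ⟨0, by simp⟩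
    | @cons x z y h w ih =>
      obtain ⟨k, hk⟩ := ih
      obtain ⟨r, hr⟩ := hv x x.2
      obtain ⟨s, hs⟩ := hv z z.2
      have hzx : (z : E) - x = (s - r) • v := by
        rw [hr, hs, vadd_eq_add, vadd_eq_add]; module
      have h1 : |s - r| * ‖v‖ = 1 := by
        have : dist (x : E) z = 1 := h
        rwa [dist_comm, dist_eq_norm, hzx, norm_smul, Real.norm_eq_abs] at this
      have h2 : inner ℝ ((y : E) - x) v = (s - r) * ‖v‖ ^ 2 + k * ‖v‖ := by
        rw [← hk, ← sub_add_sub_cancel (y : E) z x, inner_add_left, hzx, inner_smul_left,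
          real_inner_self_eq_norm_sq]
        simp [add_comm]
      rcases abs_cases (s - r) with ⟨h3, -⟩ | ⟨h3, -⟩ <;> rw [h3] at h1
      · exact ⟨k + 1, by rw [h2]; push_cast; linear_combination ‖v‖ * h1⟩
      · exact ⟨k - 1, by rw [h2]; push_cast; linear_combination -‖v‖ * h1⟩
  have hL : 0 < ‖b - a‖ := norm_pos_iff.2 (sub_ne_zero.2 hab.symm)
  -- a point of the segment `ab` at distance strictly between `0` and `1` from `a`
  set t : ℝ := min 1 (1 / (2 * ‖b - a‖)) with ht
  have ht0 : 0 < t := lt_min one_pos (by positivity)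
  have htL : t * ‖b - a‖ < 1 := by
    calc t * ‖b - a‖ ≤ 1 / (2 * ‖b - a‖) * ‖b - a‖ := by gcongr; exact min_le_right _ _
      _ = 1 / 2 := by field_simp
      _ < 1 := by norm_num
  have hc : a + t • (b - a) ∈ X := hX.add_smul_sub_mem ha hb ⟨ht0.le, min_le_left _ _⟩
  obtain ⟨w⟩ := hconn.preconnected ⟨a, ha⟩ ⟨_, hc⟩
  obtain ⟨k, hk⟩ := key w
  obtain ⟨r, hr⟩ := hv b hb
  have hba : b - a = r • v := by rw [hr]; simp
  simp only [add_sub_cancel_left] at hk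
  rw [hba, inner_smul_left, inner_smul_left, real_inner_self_eq_norm_sq] at hk
  simp only [conj_trivial] at hk
  have hk' : t * r * ‖v‖ = k := by
    apply mul_right_cancel₀ hvn.ne'
    linear_combination hk
  have habs : |(k : ℝ)| = t * ‖b - a‖ := by
    rw [← hk', abs_mul, abs_mul, abs_of_pos ht0, abs_of_pos hvn, hba, norm_smul,
      Real.norm_eq_abs, mul_assoc]
  have h1 : |k| < 1 := by
    have : (|k| : ℝ) < 1 := by rw [habs]; exact htL
    exact_mod_cast this
  rw [Int.abs_lt_one_iff] at h1
  rw [h1, Int.cast_zero, abs_zero] at habs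
  have := mul_pos ht0 hL
  linarith

theorem exists_affineIndependent_of_not_collinear {X : Set E} (h : ¬ Collinear ℝ X) :
    ∃ p : Fin 3 → E, (∀ i, p i ∈ X) ∧ AffineIndependent ℝ p := by
  by_contra! hdep
  have htriple : ∀ a ∈ X, ∀ b ∈ X, ∀ c ∈ X, Collinear ℝ {a, b, c} := by
    intro a ha b hb c hc
    rw [collinear_iff_not_affineIndependent_set]
    refine hdep _ fun i => ?_
    fin_cases i <;> simpa
  rcases X.subsingleton_or_nontrivial with hs | ⟨a, ha, b, hb, hab⟩
  · rcases hs.eq_empty_or_singleton with rfl | ⟨x, rfl⟩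
    · exact h (collinear_empty ℝ E)
    · exact h (collinear_singleton ℝ x)
  refine h ((collinear_iff_of_mem ha).2 ⟨b - a, fun c hc => ?_⟩)
  obtain ⟨v, hv⟩ := (collinear_iff_of_mem (p₀ := a) (by simp)).1 (htriple a ha b hb c hc)
  obtain ⟨s, hs⟩ := hv b (by simp)
  obtain ⟨r, hr⟩ := hv c (by simp)
  have hs0 : s ≠ 0 := by
    rintro rfl
    simp at hs
    exact hab hs.symm
  refine ⟨r / s, ?_⟩
  rw [hr, hs, vadd_eq_add, vadd_eq_add, vadd_eq_add, add_sub_cancel_right, smul_smul,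
    div_mul_cancel₀ _ hs0]

/-! ### The minimal enclosing ball -/

theorem mebRadius_eq_zero_iff {d : ℕ} {X : Set (EuclideanSpace ℝ (Fin d))} :
    mebRadius X = 0 ↔ X.Subsingleton := by
  constructor
  · intro h
    obtain ⟨v, hv⟩ := exists_subset_closedBall_mebRadius
      (mebRadius_ne_top_iff.1 (h ▸ ENNReal.zero_ne_top))
    rw [h, ENNReal.toReal_zero, closedBall_zero] at hv
    exact Set.subsingleton_singleton.anti hv
  · intro h
    rcases h.eq_empty_or_singleton with rfl | ⟨x, rfl⟩
    · exact le_antisymm (mebRadius_le (v := 0) (ρ := 0) (by simp)) zero_le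
    · exact le_antisymm (mebRadius_le (v := x) (ρ := 0) (by simp)) zero_le

/-- A closed set of radius at least `1` has a point at distance at least `1` from any given
point. -/
theorem exists_one_le_dist_of_one_le_mebRadius {d : ℕ} {X : Set (EuclideanSpace ℝ (Fin d))}
    (hXc : IsClosed X) (hr : 1 ≤ mebRadius X) (x : EuclideanSpace ℝ (Fin d)) :
    ∃ y ∈ X, 1 ≤ dist x y := by
  by_contra! h
  rcases X.eq_empty_or_nonempty with rfl | hne
  · rw [mebRadius_eq_zero_iff.2 Set.subsingleton_empty] at hr
    exact absurd hr (by simp)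
  have hcomp : IsCompact X := (isCompact_closedBall x 1).of_isClosed_subset hXc fun y hy => by
    rw [mem_closedBall, dist_comm]; exact (h y hy).le
  obtain ⟨y, hy, hmax⟩ := hcomp.exists_isMaxOn hne (f := fun y => dist x y) (by fun_prop)
  have hle : mebRadius X ≤ (nndist x y : ℝ≥0∞) := mebRadius_le (v := x) fun z hz => by
    rw [mem_closedBall, dist_comm]; exact hmax hz
  have h1 : (1 : ℝ≥0∞) ≤ (nndist x y : ℝ≥0∞) := hr.trans hle
  rw [ENNReal.one_le_coe_iff] at h1
  have := h y hy
  rw [dist_nndist] at this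
  exact absurd this (not_lt.2 (by exact_mod_cast h1))

/-- If `0 < r(X) < 1`, the centre of the minimal enclosing ball, moved to its nearest point in `X`,
is isolated in the graph. -/
theorem one_le_mebRadius_of_connected {d : ℕ} {X : Set (EuclideanSpace ℝ (Fin d))}
    (hX : Convex ℝ X) (hXc : IsClosed X) (hnt : X.Nontrivial) (hconn : (unitGraph X).Connected) :
    1 ≤ mebRadius X := by
  by_contra! hr
  obtain ⟨v, hv⟩ := exists_subset_closedBall_mebRadius (mebRadius_ne_top_iff.1 hr.ne_top)
  obtain ⟨p, hp, hpX⟩ := hX.exists_mem_forall_dist_le hXc.isComplete hnt.nonempty v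
  have : Nontrivial X := Set.nontrivial_coe_sort.2 hnt
  obtain ⟨y, hy⟩ := hconn.preconnected.exists_adj_of_nontrivial ⟨p, hp⟩
  have h1 : dist p (y : EuclideanSpace ℝ (Fin d)) = 1 := hy
  have h2 := (hpX y y.2).trans (mem_closedBall.1 (hv y.2))
  have h3 : (mebRadius X).toReal < 1 := by
    simpa using (ENNReal.toReal_lt_toReal hr.ne_top ENNReal.one_ne_top).2 hr
  rw [dist_comm] at h1
  linarith

theorem mainTheorem1 (d : ℕ) (X : Set (EuclideanSpace ℝ (Fin d)))
    (hne : X.Nonempty) (hclosed : IsClosed X) (hconvex : Convex ℝ X) :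
    (((unitDistGraph d).induce X).Connected ↔
      (mebRadius X = 0 ∨
        (1 ≤ mebRadius X ∧
          ∃ p : Fin 3 → EuclideanSpace ℝ (Fin d), (∀ i, p i ∈ X) ∧ AffineIndependent ℝ p))) ∧
    (Bornology.IsBounded X → ((unitDistGraph d).induce X).Connected →
      ((unitDistGraph d).induce X).ediam ≠ ⊤) := by
  have hG : (unitDistGraph d).induce X = unitGraph X := rfl
  rw [hG]
  have hsub : X.Subsingleton → (unitGraph X).Connected ∧ (unitGraph X).ediam ≠ ⊤ := by
    intro hs
    have : Subsingleton X := hs.coe_sort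
    have : Nonempty X := hne.to_subtype
    exact ⟨⟨.of_subsingleton⟩, by rw [SimpleGraph.ediam_eq_zero_of_subsingleton]; simp⟩
  have hmain : (1 ≤ mebRadius X ∧
      ∃ p : Fin 3 → EuclideanSpace ℝ (Fin d), (∀ i, p i ∈ X) ∧ AffineIndependent ℝ p) →
      (unitGraph X).Connected ∧ (Bornology.IsBounded X → (unitGraph X).ediam ≠ ⊤) := by
    rintro ⟨hr, p, hpX, hp⟩
    refine hconvex.unitGraph_connected hclosed hne ?_
      fun x _ => exists_one_le_dist_of_one_le_mebRadius hclosed hr x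
    rw [← hp.finrank_vectorSpan (n := 2) (by simp)]
    exact Submodule.finrank_mono (vectorSpan_mono ℝ (Set.range_subset_iff.2 hpX))
  have hconv : (unitGraph X).Connected → (mebRadius X = 0 ∨ (1 ≤ mebRadius X ∧
      ∃ p : Fin 3 → EuclideanSpace ℝ (Fin d), (∀ i, p i ∈ X) ∧ AffineIndependent ℝ p)) := by
    intro hconn
    rcases X.subsingleton_or_nontrivial with hs | hnt
    · exact .inl (mebRadius_eq_zero_iff.2 hs)
    · exact .inr ⟨one_le_mebRadius_of_connected hconvex hclosed hnt hconn,
        exists_affineIndependent_of_not_collinear fun hcol =>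
          hcol.not_connected_unitGraph hconvex hnt hconn⟩
  refine ⟨⟨hconv, ?_⟩, fun hb hconn => ?_⟩
  · rintro (h | h)
    · exact (hsub (mebRadius_eq_zero_iff.1 h)).1
    · exact (hmain h).1
  · rcases hconv hconn with h | h
    · exact (hsub (mebRadius_eq_zero_iff.1 h)).2
    · exact (hmain h).2 hb
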